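/- Let $\mathcal H$ be a class of probability distributions on $\mathbb R$ such that $\int x\,H\{dx\}=0$ and $\int x^2\,H\{dx\}=1$ for all $H\in\mathcal H$, and $\lim_{c\to\infty}\sup_{H\in\mathcal H}\int_{|x|>c}x^2\,H\{dx\}=0$. For $F\in\mathcal H$ let $(\xi_{r,s})_{r,s\in\mathbb Z}$ be i.i.d. random variables with common distribution $F$ on a probability space $(\Omega,\mathcal A,P)$. For $\mathbf a=(a_{r,s})\in\ell^2(\mathbb Z^2)$ (real) and a finite set $\Gamma\subset\mathbb Z^2$ let $$X_{j,k}=\sum_{r,s\in\mathbb Z}a_{r,s}\,\xi_{j-r,k-s}\ \text{ (convergent in } L^2(P)),\qquad S=S(\mathbf a,\Gamma)=\sum_{(j,k)\in\Gamma}X_{j,k},\qquad \sigma=\sigma(\mathbf a,\Gamma)=\sqrt{E(S^2)},$$ and, if $\sigma>0$, let $G(z)=G(z;\mathbf a,\Gamma,F)=P[S/\sigma\le z]$. Let $\Phi$ be the standard normal distribution function. For $\kappa>0$ let $\mathcal R_\kappa$ be the collection of pairs $(\mathbf a,\Gamma)$ such that $\|\mathbf a\|_2>0$, $\Gamma=\{(j,k)\in\mathbb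 Z^2:\underline M\le j\le\overline M,\ \underline N\le k\le\overline N\}$ is a non-empty rectangle, and $\sigma(\mathbf a,\Gamma)\ge\kappa\|\mathbf a\|_2$. Then, as $\kappa\to\infty$, the distribution of $S/\sigma$ converges to the standard normal distribution uniformly over $(\mathbf a,\Gamma)\in\mathcal R_\kappa$ and $F\in\mathcal H$: for every $\epsilon>0$ there is $\kappa_0=\kappa_0(\epsilon,\mathcal H)>0$ such that for all $\kappa\ge\kappa_0$, all $(\mathbf a,\Gamma)\in\mathcal R_\kappa$ and all $F\in\mathcal H$, $$\sup_{z\in\mathbb R}|G(z;\mathbf a,\Gamma,F)-\Phi(z)|\le\epsilon .$$ -/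

import Mathlib

open Filter MeasureTheory ProbabilityTheory

noncomputable section

namespace LinearField

/-- The distribution `F` on the line has mean `0` and second moment `1`.  (As `1 ≠ 0`, the second
equation forces `x ^ 2`, and hence `x`, to be `F`-integrable.) -/
structure IsStandardized (F : ProbabilityMeasure ℝ) : Prop where
  mean_eq : ∫ x, x ∂(F : Measure ℝ) = 0
  second_moment_eq : ∫ x, x ^ 2 ∂(F : Measure ℝ) = 1

/-- A class of distributions, all with mean `0` and variance `1`, with
`sup_{H ∈ 𝓗} ∫_{|x| > c} x² H{dx} → 0` as `c → ∞`. -/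
structure IsInnovationClass (𝓗 : Set (ProbabilityMeasure ℝ)) : Prop where
  standardized : ∀ H ∈ 𝓗, IsStandardized H
  tail : Tendsto
    (fun c : ℝ => ⨆ H ∈ 𝓗, ∫⁻ x in {x : ℝ | c < |x|}, ENNReal.ofReal (x ^ 2) ∂(H : Measure ℝ))
    atTop (nhds 0)

variable {Ω : Type*} [MeasurableSpace Ω] {P : Measure Ω} {F : ProbabilityMeasure ℝ}
  {ξ : ℤ × ℤ → Ω → ℝ}

/-- The `ξ_{r,s}` are i.i.d. on `(Ω, P)` with common distribution `F`, of mean `0` and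
variance `1`. -/
structure IsInnovations (P : Measure Ω) (F : ProbabilityMeasure ℝ) (ξ : ℤ × ℤ → Ω → ℝ) :
    Prop where
  standardized : IsStandardized F
  indep : iIndepFun ξ P
  law : ∀ p, HasLaw (ξ p) (F : Measure ℝ) P

theorem IsStandardized.memLp (hF : IsStandardized F) : MemLp (fun x : ℝ => x) 2 (F : Measure ℝ) := by
  rw [memLp_two_iff_integrable_sq (by fun_prop)]
  by_contra h
  have h1 := hF.second_moment_eq
  rw [integral_undef h] at h1
  exact zero_ne_one h1

theorem IsInnovations.memLp (h : IsInnovations P F ξ) (p : ℤ × ℤ) : MemLp (ξ p) 2 P := by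
  have h1 := h.standardized.memLp
  rw [← (h.law p).map_eq] at h1
  exact h1.comp_of_map (h.law p).aemeasurable

/-- The linear random field `X_{j,k} = ∑_{r,s} a_{r,s} ξ_{j-r,k-s}`, the sum being taken in
`L²(P)`; here `a ∈ ℓ²(ℤ²)`. -/
def field (h : IsInnovations P F ξ) (a : lp (fun _ : ℤ × ℤ => ℝ) 2) (j k : ℤ) : Lp ℝ 2 P :=
  ∑' p : ℤ × ℤ, a p • (h.memLp (j - p.1, k - p.2)).toLp (ξ (j - p.1, k - p.2))

/-- The series defining the field always converges unconditionally in `L²(P)`. -/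
theorem hasSum_field (h : IsInnovations P F ξ) (a : lp (fun _ : ℤ × ℤ => ℝ) 2) (j k : ℤ) :
    HasSum (fun p : ℤ × ℤ => a p • (h.memLp (j - p.1, k - p.2)).toLp (ξ (j - p.1, k - p.2)))
      (field h a j k) := by
  have key : ∀ p q : ℤ × ℤ, inner ℝ ((h.memLp p).toLp (ξ p)) ((h.memLp q).toLp (ξ q))
      = ∫ ω, ξ q ω * ξ p ω ∂P := by
    intro p q
    rw [L2.inner_def]
    apply integral_congr_ae
    filter_upwards [(h.memLp p).coeFn_toLp, (h.memLp q).coeFn_toLp] with ω h1 h2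
    simp [h1, h2]
  have on : Orthonormal ℝ (fun p : ℤ × ℤ =>
      (h.memLp (j - p.1, k - p.2)).toLp (ξ (j - p.1, k - p.2))) := by
    rw [orthonormal_iff_ite]
    intro p q
    rw [key]
    split_ifs with hpq
    · subst hpq
      have h1 := (h.law (j - p.1, k - p.2)).integral_comp (f := fun x => x * x) (by fun_prop)
      have h2 := h.standardized.second_moment_eq
      simp only [pow_two] at h2
      rw [h2] at h1
      exact h1
    · have hne : (j - q.1, k - q.2) ≠ (j - p.1, k - p.2) := by
        intro he
        apply hpq
        simp only [Prod.mk.injEq] at he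
        ext <;> omega
      have h1 := (h.law (j - p.1, k - p.2)).integral_eq
      have h3 := (h.indep.indepFun hne).integral_mul_eq_mul_integral
        (h.memLp _).aestronglyMeasurable (h.memLp _).aestronglyMeasurable
      have h4 := h.standardized.mean_eq
      simp only [Pi.mul_apply] at h3
      rw [h3, h1, h4, mul_zero]
  have hs := on.orthogonalFamily.summable_of_lp a
  exact Summable.hasSum (by simpa [LinearIsometry.toSpanSingleton_apply] using hs)

/-- `S(a, Γ) = ∑_{(j,k) ∈ Γ} X_{j,k}`. -/
def S (h : IsInnovations P F ξ) (a : lp (fun _ : ℤ × ℤ => ℝ) 2) (Γ : Finset (ℤ × ℤ)) : Lp ℝ 2 P :=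
  ∑ p ∈ Γ, field h a p.1 p.2

/-- `σ(a, Γ)`, the nonnegative square root of `E(S²)`. -/
def σ (h : IsInnovations P F ξ) (a : lp (fun _ : ℤ × ℤ => ℝ) 2) (Γ : Finset (ℤ × ℤ)) : ℝ :=
  √(∫ ω, (S h a Γ ω) ^ 2 ∂P)

/-- `G(z) = P[S / σ ≤ z]`. -/
def G (h : IsInnovations P F ξ) (a : lp (fun _ : ℤ × ℤ => ℝ) 2) (Γ : Finset (ℤ × ℤ)) (z : ℝ) : ℝ :=
  P.real {ω | S h a Γ ω / σ h a Γ ≤ z}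

/-- The standard normal distribution function. -/
def Φ (z : ℝ) : ℝ := (gaussianReal 0 1).real (Set.Iic z)

/-- `Γ` is a (nonempty, finite) rectangle `{(j,k) : M₁ ≤ j ≤ M₂, N₁ ≤ k ≤ N₂}`. -/
def IsRectangle (Γ : Finset (ℤ × ℤ)) : Prop :=
  ∃ M₁ M₂ N₁ N₂ : ℤ, M₁ ≤ M₂ ∧ N₁ ≤ N₂ ∧ Γ = Finset.Icc M₁ M₂ ×ˢ Finset.Icc N₁ N₂

/-- The collection `𝓡_κ` of pairs `(a, Γ)` with `‖a‖₂ > 0`, `Γ` a rectangle and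
`σ(a, Γ) ≥ κ ‖a‖₂`. -/
def R (h : IsInnovations P F ξ) (κ : ℝ) : Set (lp (fun _ : ℤ × ℤ => ℝ) 2 × Finset (ℤ × ℤ)) :=
  {q | 0 < ‖q.1‖ ∧ IsRectangle q.2 ∧ κ * ‖q.1‖ ≤ σ h q.1 q.2}

end LinearField

end

/-! Reindexing gives `S = ∑ b_q ξ_q` with `b_q = ∑_{p ∈ Γ} a (p - q)` and `σ² = ∑ b_q²`, so this is
a Lindeberg problem: the point is that `max |b_q| / σ` is uniformly small for large `κ`.

Because `Γ` is a rectangle, a unit mixed difference of `b` telescopes to four values of `a`, so it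
is at most `4‖a‖ ≤ 4σ/κ`. Hence on an `N × N` box `b_q` is, up to `4N²σ/κ`, the combination
`b_{q+(i,0)} + b_{q+(0,j)} - b_{q+(i,j)}`. Averaging squares over the box and using `∑ b² = σ²`
yields `b_q² ≤ (12/N + 64N⁴/κ²) σ²` (`sq_le_of_mixed_difference_le`, `weight_sq_le`); take `N`
large, then `κ` large.

Lindeberg's comparison of characteristic functions, with one truncation level for all of `𝓗`, then
gives convergence to the Gaussian at each `t`, uniformly over the admissible laws. Lévy's continuity
theorem and Pólya's theorem, applied to a sequence of putative counterexamples, turn this into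
uniform closeness of distribution functions. -/

/-! ### Pólya's theorem on distribution functions -/

theorem continuous_cdf_of_nullSingletonClass (ν : Measure ℝ) [IsProbabilityMeasure ν]
    [NullSingletonClass ν] : Continuous (cdf ν) := by
  rw [continuous_iff_continuousAt]
  intro x
  rw [(monotone_cdf ν).continuousAt_iff_leftLim_eq_rightLim, StieltjesFunction.rightLim_eq]
  have h := (cdf ν).measure_singleton x
  rw [measure_cdf, measure_singleton] at h
  exact le_antisymm ((monotone_cdf ν).leftLim_le le_rfl)
    (sub_nonpos.1 (ENNReal.ofReal_eq_zero.1 h.symm))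

theorem exists_cdf_eq (ν : Measure ℝ) [IsProbabilityMeasure ν] [NullSingletonClass ν]
    {y : ℝ} (h0 : 0 < y) (h1 : y < 1) : ∃ x, cdf ν x = y := by
  obtain ⟨u, hu⟩ := ((tendsto_cdf_atBot ν).eventually (gt_mem_nhds h0)).exists
  obtain ⟨v, hv⟩ := ((tendsto_cdf_atTop ν).eventually (lt_mem_nhds h1)).exists
  exact mem_range_of_exists_le_of_exists_ge (continuous_cdf_of_nullSingletonClass ν)
    ⟨u, hu.le⟩ ⟨v, hv.le⟩

/-- A finite set of points discretising the distribution function of an atomless law. -/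
theorem exists_finset_cdf_grid (ν : Measure ℝ) [IsProbabilityMeasure ν] [NullSingletonClass ν]
    {ε : ℝ} (hε : 0 < ε) :
    ∃ A : Finset ℝ, ∀ z,
      (ε < cdf ν z → ∃ x ∈ A, x ≤ z ∧ cdf ν z ≤ cdf ν x + ε) ∧
      (cdf ν z < 1 - ε → ∃ x ∈ A, z ≤ x ∧ cdf ν x ≤ cdf ν z + ε) := by
  classical
  obtain ⟨K, hK⟩ := exists_nat_gt (2 / ε)
  have hK0 : (0 : ℝ) < K := lt_trans (by positivity) hK
  have hKε : 2 < K * ε := by rwa [div_lt_iff₀ hε] at hK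
  -- Quantiles at the levels `i / K`. Levels 0 and 1 need not be attained, so `x 0` is arbitrary; an
  -- extra point in the grid is harmless.
  have ex : ∀ i : ℕ, ∃ x, 0 < i → i < K → cdf ν x = i / K := by
    intro i
    by_cases h : 0 < i ∧ i < K
    · have hi0 : (0 : ℝ) < i := by exact_mod_cast h.1
      have hi1 : (i : ℝ) < K := by exact_mod_cast h.2
      obtain ⟨x, hx⟩ := exists_cdf_eq ν (y := i / K) (by positivity) ((div_lt_one hK0).2 hi1)
      exact ⟨x, fun _ _ => hx⟩
    · exact ⟨0, fun h0 h1 => absurd ⟨h0, h1⟩ h⟩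
  choose x hx using ex
  have hle := cdf_le_one ν
  have hnn := cdf_nonneg ν
  refine ⟨(Finset.range K).image x, fun z => ⟨fun hz => ?_, fun hz => ?_⟩⟩
  -- Ceiling minus one rather than floor: `i / K` must be strictly below `cdf ν z`, since only a
  -- strict inequality of values orders the arguments of a monotone function.
  · obtain ⟨i, hi⟩ : ∃ i, ⌈(K : ℝ) * cdf ν z⌉₊ = i + 1 := by
      refine Nat.exists_eq_succ_of_ne_zero (Nat.ceil_pos.2 ?_).ne'
      have := hε.trans hz
      positivity
    have h1 : (K : ℝ) * cdf ν z ≤ i + 1 := by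
      have := Nat.le_ceil ((K : ℝ) * cdf ν z)
      rw [hi] at this
      exact_mod_cast this
    have h2 : (i : ℝ) < K * cdf ν z := Nat.lt_ceil.1 (by omega)
    have h3 : (i : ℝ) < K := by nlinarith [hle z]
    have h4 : (0 : ℝ) < i := by nlinarith
    have hxi := hx i (by exact_mod_cast h4) (by exact_mod_cast h3)
    refine ⟨x i, Finset.mem_image_of_mem _ (Finset.mem_range.2 (by exact_mod_cast h3)), ?_, ?_⟩
    · refine le_of_lt ((monotone_cdf ν).reflect_lt ?_)
      rw [hxi, div_lt_iff₀ hK0]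
      linarith
    · rw [hxi, ← sub_le_iff_le_add, le_div_iff₀ hK0]
      nlinarith
  · set i := ⌊(K : ℝ) * cdf ν z⌋₊ + 1 with hi
    have h1 : (K : ℝ) * cdf ν z < i := by
      rw [hi]
      exact_mod_cast Nat.lt_floor_add_one ((K : ℝ) * cdf ν z)
    have h2 : (i : ℝ) ≤ K * cdf ν z + 1 := by
      rw [hi]
      push_cast
      have := Nat.floor_le (mul_nonneg hK0.le (hnn z))
      linarith
    have h3 : (i : ℝ) < K := by nlinarith
    have hxi := hx i (by omega) (by exact_mod_cast h3)
    refine ⟨x i, Finset.mem_image_of_mem _ (Finset.mem_range.2 (by exact_mod_cast h3)), ?_, ?_⟩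
    · refine le_of_lt ((monotone_cdf ν).reflect_lt ?_)
      rw [hxi, lt_div_iff₀ hK0]
      linarith
    · rw [hxi, div_le_iff₀ hK0]
      nlinarith

/-- Pólya: weak convergence to an atomless law makes the distribution functions converge
uniformly. -/
theorem eventually_forall_abs_cdf_sub_le {μ : ℕ → ProbabilityMeasure ℝ} {ν : ProbabilityMeasure ℝ}
    [NullSingletonClass (ν : Measure ℝ)] (h : Tendsto μ atTop (nhds ν)) {ε : ℝ} (hε : 0 < ε) :
    ∀ᶠ n in atTop, ∀ z, |cdf (μ n : Measure ℝ) z - cdf (ν : Measure ℝ) z| ≤ ε := by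
  obtain ⟨A, hA⟩ := exists_finset_cdf_grid (ν : Measure ℝ) (half_pos hε)
  have hx : ∀ x ∈ A, ∀ᶠ n in atTop,
      |cdf (μ n : Measure ℝ) x - cdf (ν : Measure ℝ) x| < ε / 2 := by
    intro x _
    have h1 := ProbabilityMeasure.tendsto_measure_of_null_frontier_of_tendsto' h
      (E := Set.Iic x) (by simp)
    have h2 := (ENNReal.tendsto_toReal (measure_ne_top _ _)).comp h1
    have h3 : Tendsto (fun n => cdf (μ n : Measure ℝ) x) atTop (nhds (cdf (ν : Measure ℝ) x)) := by
      simp only [cdf_eq_real]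
      exact h2
    simpa [Real.dist_eq] using Metric.tendsto_nhds.1 h3 (ε / 2) (half_pos hε)
  filter_upwards [(eventually_all_finset A).2 hx] with n hn z
  have hb := cdf_nonneg (μ n : Measure ℝ) z
  have ht := cdf_le_one (μ n : Measure ℝ) z
  rw [abs_le]
  constructor
  · rcases le_or_gt (cdf (ν : Measure ℝ) z) (ε / 2) with hz | hz
    · linarith
    · obtain ⟨x, hxA, hxz, hle⟩ := (hA z).1 hz
      have h1 := (abs_lt.1 (hn x hxA)).1
      have h2 := monotone_cdf (μ n : Measure ℝ) hxz
      linarith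
  · rcases le_or_gt (1 - ε / 2) (cdf (ν : Measure ℝ) z) with hz | hz
    · linarith
    · obtain ⟨x, hxA, hxz, hle⟩ := (hA z).2 hz
      have h1 := (abs_lt.1 (hn x hxA)).2
      have h2 := monotone_cdf (μ n : Measure ℝ) hxz
      linarith

/-! ### Elementary inequalities for exponentials and products -/

theorem norm_exp_I_sub_taylor_le_of_le_one {x : ℝ} (hx : |x| ≤ 1) :
    ‖Complex.exp (x * Complex.I) - (1 + x * Complex.I - (x : ℂ) ^ 2 / 2)‖ ≤ |x| ^ 3 := by
  have hn : ‖(x : ℂ) * Complex.I‖ = |x| := by simp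
  have h := Complex.exp_bound (x := x * Complex.I) (by rwa [hn]) (n := 3) (by norm_num)
  rw [hn] at h
  have e : ∑ m ∈ Finset.range 3, ((x : ℂ) * Complex.I) ^ m / (m.factorial : ℂ)
      = 1 + x * Complex.I - (x : ℂ) ^ 2 / 2 := by
    simp [Finset.sum_range_succ, mul_pow, Nat.factorial]
    ring
  rw [e] at h
  refine h.trans (mul_le_of_le_one_right (by positivity) ?_)
  norm_num [Nat.factorial]

theorem norm_exp_I_sub_taylor_le_of_one_le {x : ℝ} (hx : 1 ≤ |x|) :
    ‖Complex.exp (x * Complex.I) - (1 + x * Complex.I - (x : ℂ) ^ 2 / 2)‖ ≤ 4 * |x| ^ 2 := by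
  have h1 : ‖Complex.exp (x * Complex.I)‖ = 1 := Complex.norm_exp_ofReal_mul_I x
  have h2 : ‖(1 + x * Complex.I - (x : ℂ) ^ 2 / 2)‖ ≤ 1 + |x| + |x| ^ 2 / 2 := by
    refine (norm_sub_le _ _).trans (add_le_add ((norm_add_le _ _).trans ?_) ?_) <;> simp
  refine (norm_sub_le _ _).trans ?_
  nlinarith

/-- For the tail of a law with only two moments; the cubic bound below serves the truncated part. -/
theorem norm_exp_I_sub_taylor_le_sq (x : ℝ) :
    ‖Complex.exp (x * Complex.I) - (1 + x * Complex.I - (x : ℂ) ^ 2 / 2)‖ ≤ 4 * |x| ^ 2 := by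
  rcases le_total |x| 1 with h | h
  · refine (norm_exp_I_sub_taylor_le_of_le_one h).trans ?_
    have := abs_nonneg x
    nlinarith [pow_le_pow_of_le_one this h (show 2 ≤ 3 by norm_num), sq_nonneg |x|]
  · exact norm_exp_I_sub_taylor_le_of_one_le h

theorem norm_exp_I_sub_taylor_le_cube (x : ℝ) :
    ‖Complex.exp (x * Complex.I) - (1 + x * Complex.I - (x : ℂ) ^ 2 / 2)‖ ≤ 4 * |x| ^ 3 := by
  rcases le_total |x| 1 with h | h
  · refine (norm_exp_I_sub_taylor_le_of_le_one h).trans ?_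
    have := pow_nonneg (abs_nonneg x) 3
    linarith
  · refine (norm_exp_I_sub_taylor_le_of_one_le h).trans ?_
    have := pow_le_pow_right₀ h (show 2 ≤ 3 by norm_num)
    linarith

theorem abs_exp_neg_sub_taylor_le {y : ℝ} (hy : 0 ≤ y) : |Real.exp (-y) - (1 - y)| ≤ y ^ 2 := by
  rw [abs_of_nonneg (by linarith [Real.one_sub_le_exp_neg y])]
  rcases le_total y 1 with h | h
  · have h1 := Real.abs_exp_sub_one_sub_id_le (x := -y) (by rwa [abs_neg, abs_of_nonneg hy])
    have h2 := (abs_le.1 h1).2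
    nlinarith
  · have : Real.exp (-y) ≤ 1 := Real.exp_le_one_iff.2 (by linarith)
    nlinarith

/-- Exchange the factors one at a time; all the others have modulus at most 1. -/
theorem norm_prod_sub_prod_le_sum {ι : Type*} (s : Finset ι) (f g : ι → ℂ)
    (hf : ∀ i ∈ s, ‖f i‖ ≤ 1) (hg : ∀ i ∈ s, ‖g i‖ ≤ 1) :
    ‖∏ i ∈ s, f i - ∏ i ∈ s, g i‖ ≤ ∑ i ∈ s, ‖f i - g i‖ := by
  classical
  induction s using Finset.induction_on with
  | empty => simp
  | insert a s ha ih =>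
    have ih' := ih (fun i hi => hf i (Finset.mem_insert_of_mem hi))
      (fun i hi => hg i (Finset.mem_insert_of_mem hi))
    rw [Finset.prod_insert ha, Finset.prod_insert ha, Finset.sum_insert ha]
    have e : f a * ∏ i ∈ s, f i - g a * ∏ i ∈ s, g i
        = (f a - g a) * ∏ i ∈ s, f i + g a * (∏ i ∈ s, f i - ∏ i ∈ s, g i) := by ring
    have hp : ‖∏ i ∈ s, f i‖ ≤ 1 := by
      rw [norm_prod]
      exact Finset.prod_le_one (fun _ _ => norm_nonneg _)
        (fun i hi => hf i (Finset.mem_insert_of_mem hi))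
    rw [e]
    refine (norm_add_le _ _).trans (add_le_add ?_ ?_)
    · rw [norm_mul]
      exact mul_le_of_le_one_right (norm_nonneg _) hp
    · rw [norm_mul]
      exact (mul_le_of_le_one_left (norm_nonneg _) (hg a (Finset.mem_insert_self a s))).trans ih'

/-! ### Characteristic function of a standardized law -/

namespace LinearField

variable {F : ProbabilityMeasure ℝ}

theorem IsStandardized.integrable_sq (hF : IsStandardized F) :
    Integrable (fun x : ℝ => x ^ 2) (F : Measure ℝ) := hF.memLp.integrable_sq

theorem IsStandardized.integrable_id (hF : IsStandardized F) :
    Integrable (fun x : ℝ => x) (F : Measure ℝ) := hF.memLp.integrable (by norm_num)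

/-- Second order expansion of the characteristic function, with a remainder controlled by the
truncated second moment. -/
theorem IsStandardized.norm_charFun_sub_le (hF : IsStandardized F) {c τ : ℝ} (hc : 0 ≤ c)
    (hτ : ∫ x in {x : ℝ | c < |x|}, x ^ 2 ∂(F : Measure ℝ) ≤ τ) (u : ℝ) :
    ‖charFun (F : Measure ℝ) u - (1 - (u : ℂ) ^ 2 / 2)‖ ≤ 4 * u ^ 2 * (|u| * c + τ) := by
  have h2 := hF.integrable_sq
  have h1 := hF.integrable_id
  have hms : MeasurableSet {x : ℝ | c < |x|} := measurableSet_lt measurable_const measurable_norm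
  have iexp : Integrable (fun x : ℝ => Complex.exp (u * x * Complex.I)) (F : Measure ℝ) := by
    refine (integrable_const (1 : ℝ)).mono' (by fun_prop) (ae_of_all _ fun x => ?_)
    rw [← Complex.ofReal_mul, Complex.norm_exp_ofReal_mul_I]
  have i1 : Integrable (fun x : ℝ => (u : ℂ) * x * Complex.I) (F : Measure ℝ) :=
    (h1.ofReal.const_mul (u : ℂ)).mul_const _
  have i2 : Integrable (fun x : ℝ => ((u : ℂ) * x) ^ 2 / 2) (F : Measure ℝ) := by
    have := (h2.ofReal (𝕜 := ℂ)).const_mul ((u : ℂ) ^ 2 / 2)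
    refine this.congr (ae_of_all _ fun x => ?_)
    simp
    ring
  have e : charFun (F : Measure ℝ) u - (1 - (u : ℂ) ^ 2 / 2)
      = ∫ x, (Complex.exp (u * x * Complex.I)
          - (1 + (u : ℂ) * x * Complex.I - ((u : ℂ) * x) ^ 2 / 2)) ∂(F : Measure ℝ) := by
    have i01 : Integrable (fun x : ℝ => 1 + (u : ℂ) * x * Complex.I) (F : Measure ℝ) :=
      (integrable_const _).add i1
    have i012 : Integrable (fun x : ℝ => 1 + (u : ℂ) * x * Complex.I - ((u : ℂ) * x) ^ 2 / 2)
        (F : Measure ℝ) := i01.sub i2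
    rw [integral_sub iexp i012, integral_sub i01 i2, integral_add (integrable_const _) i1,
      charFun_apply_real, integral_mul_const, integral_const_mul, integral_complex_ofReal,
      hF.mean_eq]
    have : ∫ x, ((u : ℂ) * x) ^ 2 / 2 ∂(F : Measure ℝ) = (u : ℂ) ^ 2 / 2 := by
      calc ∫ x, ((u : ℂ) * x) ^ 2 / 2 ∂(F : Measure ℝ)
          = ∫ x, (u : ℂ) ^ 2 / 2 * ((x ^ 2 : ℝ) : ℂ) ∂(F : Measure ℝ) := by
            congr with x
            push_cast
            ring
        _ = _ := by
            rw [integral_const_mul, integral_complex_ofReal, hF.second_moment_eq]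
            simp
    rw [this]
    simp
  have itail : Integrable ({x : ℝ | c < |x|}.indicator fun x => x ^ 2) (F : Measure ℝ) :=
    h2.indicator hms
  rw [e]
  calc _ ≤ ∫ x, (4 * u ^ 2 * (|u| * c) * x ^ 2
          + 4 * u ^ 2 * {x : ℝ | c < |x|}.indicator (fun x => x ^ 2) x) ∂(F : Measure ℝ) := by
        refine norm_integral_le_of_norm_le ((h2.const_mul _).add (itail.const_mul _))
          (ae_of_all _ fun x => ?_)
        rw [← Complex.ofReal_mul]
        by_cases hx : c < |x|
        · rw [Set.indicator_of_mem (show x ∈ {x : ℝ | c < |x|} from hx)]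
          refine (norm_exp_I_sub_taylor_le_sq (u * x)).trans ?_
          rw [sq_abs]
          have : 0 ≤ 4 * u ^ 2 * (|u| * c) * x ^ 2 := by positivity
          nlinarith
        · rw [Set.indicator_of_notMem (show x ∉ {x : ℝ | c < |x|} from hx)]
          refine (norm_exp_I_sub_taylor_le_cube (u * x)).trans ?_
          have e3 : |u * x| ^ 3 = u ^ 2 * |u| * x ^ 2 * |x| := by
            rw [abs_mul, ← sq_abs u, ← sq_abs x]
            ring
          rw [e3]
          have h4 : 0 ≤ u ^ 2 * |u| * x ^ 2 := by positivity
          have := mul_le_mul_of_nonneg_left (not_lt.1 hx) h4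
          nlinarith
    _ = 4 * u ^ 2 * (|u| * c) * 1 + 4 * u ^ 2 * ∫ x in {x : ℝ | c < |x|}, x ^ 2 ∂(F : Measure ℝ) := by
        rw [integral_add (h2.const_mul _) (itail.const_mul _), integral_const_mul,
          integral_const_mul, hF.second_moment_eq, integral_indicator hms]
    _ ≤ _ := by
        have := mul_le_mul_of_nonneg_left hτ (show 0 ≤ 4 * u ^ 2 by positivity)
        nlinarith

/-- Unlike the quadratic, the Gaussian factor multiplies exactly over independent summands. The
prefactor `u ^ 2` makes the errors add up to a multiple of the total variance. -/
theorem IsStandardized.norm_charFun_sub_exp_le (hF : IsStandardized F) {c τ : ℝ} (hc : 0 ≤ c)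
    (hτ : ∫ x in {x : ℝ | c < |x|}, x ^ 2 ∂(F : Measure ℝ) ≤ τ) (u : ℝ) :
    ‖charFun (F : Measure ℝ) u - Real.exp (-(u ^ 2 / 2))‖
      ≤ u ^ 2 * (4 * (|u| * c + τ) + u ^ 2) := by
  have h1 := hF.norm_charFun_sub_le hc hτ u
  have h2 := abs_exp_neg_sub_taylor_le (y := u ^ 2 / 2) (by positivity)
  have h3 : ‖(1 - (u : ℂ) ^ 2 / 2) - Real.exp (-(u ^ 2 / 2))‖ ≤ (u ^ 2 / 2) ^ 2 := by
    rw [norm_sub_rev]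
    refine le_trans (le_of_eq ?_) h2
    rw [← Real.norm_eq_abs, ← Complex.norm_real]
    push_cast
    rfl
  refine (norm_sub_le_norm_sub_add_norm_sub _ (1 - (u : ℂ) ^ 2 / 2) _).trans ?_
  nlinarith [sq_nonneg (u ^ 2)]

theorem IsInnovationClass.exists_tail_le {𝓗 : Set (ProbabilityMeasure ℝ)}
    (h𝓗 : IsInnovationClass 𝓗) {τ : ℝ} (hτ : 0 < τ) :
    ∃ c : ℝ, 0 ≤ c ∧ ∀ H ∈ 𝓗, ∫ x in {x : ℝ | c < |x|}, x ^ 2 ∂(H : Measure ℝ) ≤ τ := by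
  obtain ⟨c, hc, hc0⟩ := ((h𝓗.tail.eventually (gt_mem_nhds (ENNReal.ofReal_pos.2 hτ))).and
    (eventually_ge_atTop 0)).exists
  refine ⟨c, hc0, fun H hH => ?_⟩
  rw [integral_eq_lintegral_of_nonneg_ae (ae_of_all _ fun x => sq_nonneg x) (by fun_prop)]
  refine ENNReal.toReal_le_of_le_ofReal hτ.le (le_trans ?_ hc.le)
  exact le_iSup₂ (f := fun (H : ProbabilityMeasure ℝ) (_ : H ∈ 𝓗) =>
    ∫⁻ x in {x : ℝ | c < |x|}, ENNReal.ofReal (x ^ 2) ∂(H : Measure ℝ)) H hH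

end LinearField

/-! ### The sum `S` as a weighted series of innovations -/

namespace LinearField

variable {Ω : Type*} [MeasurableSpace Ω] {P : Measure Ω} {F : ProbabilityMeasure ℝ}
  {ξ : ℤ × ℤ → Ω → ℝ}

theorem IsInnovations.orthonormal (h : IsInnovations P F ξ) :
    Orthonormal ℝ (fun p => (h.memLp p).toLp (ξ p)) := by
  have key : ∀ p q : ℤ × ℤ, inner ℝ ((h.memLp p).toLp (ξ p)) ((h.memLp q).toLp (ξ q))
      = ∫ ω, ξ q ω * ξ p ω ∂P := by
    intro p q
    rw [L2.inner_def]
    apply integral_congr_ae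
    filter_upwards [(h.memLp p).coeFn_toLp, (h.memLp q).coeFn_toLp] with ω h1 h2
    simp [h1, h2]
  rw [orthonormal_iff_ite]
  intro p q
  rw [key]
  split_ifs with hpq
  · subst hpq
    have h1 := (h.law p).integral_comp (f := fun x => x * x) (by fun_prop)
    have h2 := h.standardized.second_moment_eq
    simp only [pow_two] at h2
    exact h1.trans h2
  · have h1 := (h.law p).integral_eq
    have h3 := (h.indep.indepFun (Ne.symm hpq)).integral_mul_eq_mul_integral
      (h.memLp _).aestronglyMeasurable (h.memLp _).aestronglyMeasurable
    simp only [Pi.mul_apply] at h3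
    rw [h3, h1, h.standardized.mean_eq, mul_zero]

/-- The coefficient of `ξ q` in `S(a, Γ)`. -/
def weight (a : lp (fun _ : ℤ × ℤ => ℝ) 2) (Γ : Finset (ℤ × ℤ)) (q : ℤ × ℤ) : ℝ :=
  ∑ p ∈ Γ, a (p - q)

/-- Substitute `q ↦ p - q` in each field series, then interchange it with the finite sum over `Γ`.
-/
theorem hasSum_S (h : IsInnovations P F ξ) (a : lp (fun _ : ℤ × ℤ => ℝ) 2)
    (Γ : Finset (ℤ × ℤ)) :
    HasSum (fun q => weight a Γ q • (h.memLp q).toLp (ξ q)) (S h a Γ) := by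
  have h1 : ∀ p ∈ Γ, HasSum (fun q => a (p - q) • (h.memLp q).toLp (ξ q)) (field h a p.1 p.2) := by
    intro p _
    rw [← (Equiv.subLeft p).hasSum_iff]
    refine (hasSum_field h a p.1 p.2).congr_fun ?_
    intro q
    simp [Prod.sub_def]
  have h2 := hasSum_sum h1
  simp only [weight, Finset.sum_smul]
  exact h2

theorem hasSum_weight_sq (h : IsInnovations P F ξ) (a : lp (fun _ : ℤ × ℤ => ℝ) 2)
    (Γ : Finset (ℤ × ℤ)) : HasSum (fun q => weight a Γ q ^ 2) (σ h a Γ ^ 2) := by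
  have h1 := hasSum_S h a Γ
  have hσ : σ h a Γ ^ 2 = ‖S h a Γ‖ ^ 2 := by
    rw [σ, Real.sq_sqrt (integral_nonneg fun ω => sq_nonneg _), ← real_inner_self_eq_norm_sq,
      L2.inner_def]
    simp [pow_two]
  rw [hσ]
  -- Parseval: pass to the limit in the squared norms of the finite partial sums.
  have h2 := ((continuous_norm.pow 2).tendsto (S h a Γ)).comp h1
  refine h2.congr fun s => ?_
  change ‖∑ q ∈ s, weight a Γ q • (h.memLp q).toLp (ξ q)‖ ^ 2 = _
  rw [← real_inner_self_eq_norm_sq, h.orthonormal.inner_sum]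
  simp [pow_two]

end LinearField

/-! ### Mixed differences and smallness of the weights -/

/-- The increment over a rectangle is the sum of the unit mixed differences inside it. -/
theorem sum_range_mixed_difference (f : ℕ → ℕ → ℝ) (m n : ℕ) :
    ∑ i ∈ Finset.range m, ∑ j ∈ Finset.range n,
        (f (i + 1) (j + 1) - f (i + 1) j - (f i (j + 1) - f i j))
      = f m n - f m 0 - (f 0 n - f 0 0) := by
  have h : ∀ i, ∑ j ∈ Finset.range n, (f (i + 1) (j + 1) - f (i + 1) j - (f i (j + 1) - f i j))
      = (f (i + 1) n - f (i + 1) 0) - (f i n - f i 0) := by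
    intro i
    rw [Finset.sum_sub_distrib, Finset.sum_range_sub, Finset.sum_range_sub]
  simp_rw [h]
  exact Finset.sum_range_sub (fun i => f i n - f i 0) m

theorem abs_rectangle_increment_le {f : ℕ → ℕ → ℝ} {η : ℝ}
    (hη : ∀ i j, |f (i + 1) (j + 1) - f (i + 1) j - (f i (j + 1) - f i j)| ≤ η) (m n : ℕ) :
    |f m n - f m 0 - (f 0 n - f 0 0)| ≤ m * n * η := by
  rw [← sum_range_mixed_difference]
  calc _ ≤ ∑ i ∈ Finset.range m, ∑ j ∈ Finset.range n, η :=
        (Finset.abs_sum_le_sum_abs _ _).trans (Finset.sum_le_sum fun i _ =>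
          (Finset.abs_sum_le_sum_abs _ _).trans (Finset.sum_le_sum fun j _ => hη i j))
    _ = _ := by simp; ring

/-- A square summable function on the lattice with small mixed differences is uniformly small
compared with its norm. -/
theorem sq_le_of_mixed_difference_le {b : ℤ × ℤ → ℝ} {B η : ℝ}
    (hB : ∀ s : Finset (ℤ × ℤ), ∑ p ∈ s, b p ^ 2 ≤ B)
    (hη : ∀ r s : ℤ, |b (r + 1, s + 1) - b (r + 1, s) - (b (r, s + 1) - b (r, s))| ≤ η)
    (q : ℤ × ℤ) {N : ℕ} (hN : 0 < N) :
    b q ^ 2 ≤ 12 / N * B + 4 * (N ^ 2 * η) ^ 2 := by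
  have hη0 : 0 ≤ η := (abs_nonneg _).trans (hη 0 0)
  have hB0 : 0 ≤ B := by simpa using hB ∅
  set f : ℕ → ℕ → ℝ := fun i j => b (q.1 + i, q.2 + j) with hf
  have hfη : ∀ i j, |f (i + 1) (j + 1) - f (i + 1) j - (f i (j + 1) - f i j)| ≤ η := by
    intro i j
    have := hη (q.1 + i) (q.2 + j)
    simpa [hf, add_assoc] using this
  have h0 : b q = f 0 0 := by simp [hf]
  have hN' : (0 : ℝ) < N := by exact_mod_cast hN
  have pt : ∀ i ∈ Finset.Icc 1 N, ∀ j ∈ Finset.Icc 1 N,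
      b q ^ 2 ≤ 4 * (f i 0 ^ 2 + f 0 j ^ 2 + f i j ^ 2 + (N ^ 2 * η) ^ 2) := by
    intro i hi j hj
    have h1 := abs_rectangle_increment_le hfη i j
    have h2 : (i : ℝ) * j * η ≤ N ^ 2 * η := by
      have hiN : (i : ℝ) ≤ N := by exact_mod_cast (Finset.mem_Icc.1 hi).2
      have hjN : (j : ℝ) ≤ N := by exact_mod_cast (Finset.mem_Icc.1 hj).2
      rw [pow_two]
      gcongr
    have h3 := sq_le_sq' (abs_le.1 (h1.trans h2)).1 (abs_le.1 (h1.trans h2)).2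
    rw [h0]
    set e := f i j - f i 0 - (f 0 j - f 0 0) with he
    have : f 0 0 = f i 0 + f 0 j - f i j + e := by rw [he]; ring
    rw [this]
    -- Cauchy–Schwarz for four terms: the six squares add up to the difference of the two sides.
    nlinarith [sq_nonneg (f i 0 - f 0 j), sq_nonneg (f i 0 + f i j), sq_nonneg (f i 0 - e),
      sq_nonneg (f 0 j + f i j), sq_nonneg (f 0 j - e), sq_nonneg (f i j + e)]
  have sB : ∀ (ι : Type) (s : Finset ι) (g : ι → ℤ × ℤ), Function.Injective g →
      ∑ i ∈ s, b (g i) ^ 2 ≤ B := by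
    intro ι s g hg
    have := hB (s.map ⟨g, hg⟩)
    simpa using this
  have s1 : ∑ i ∈ Finset.Icc 1 N, f i 0 ^ 2 ≤ B :=
    sB ℕ _ (fun i => (q.1 + i, q.2 + (0 : ℕ))) (fun i j h => by simpa using h)
  have s2 : ∑ j ∈ Finset.Icc 1 N, f 0 j ^ 2 ≤ B :=
    sB ℕ _ (fun i => (q.1 + (0 : ℕ), q.2 + i)) (fun i j h => by simpa using h)
  have s3 : ∑ i ∈ Finset.Icc 1 N, ∑ j ∈ Finset.Icc 1 N, f i j ^ 2 ≤ B := by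
    rw [← Finset.sum_product']
    exact sB (ℕ × ℕ) _ (fun p => (q.1 + p.1, q.2 + p.2))
      (fun p p' h => by simpa [Prod.ext_iff] using h)
  have tot := Finset.sum_le_sum fun i hi => Finset.sum_le_sum fun j hj => pt i hi j hj
  have el : ∑ i ∈ Finset.Icc 1 N, ∑ j ∈ Finset.Icc 1 N, b q ^ 2 = N ^ 2 * b q ^ 2 := by
    simp
    ring
  have er : ∑ i ∈ Finset.Icc 1 N, ∑ j ∈ Finset.Icc 1 N,
        4 * (f i 0 ^ 2 + f 0 j ^ 2 + f i j ^ 2 + (N ^ 2 * η) ^ 2)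
      = 4 * (N * ∑ i ∈ Finset.Icc 1 N, f i 0 ^ 2 + N * ∑ j ∈ Finset.Icc 1 N, f 0 j ^ 2
        + ∑ i ∈ Finset.Icc 1 N, ∑ j ∈ Finset.Icc 1 N, f i j ^ 2
        + N ^ 2 * (N ^ 2 * η) ^ 2) := by
    simp only [← Finset.mul_sum, Finset.sum_add_distrib, Finset.sum_const, Nat.card_Icc,
      Nat.add_sub_cancel, nsmul_eq_mul]
    ring
  rw [el, er] at tot
  have hN1 : (1 : ℝ) ≤ N := by exact_mod_cast hN
  -- Each axis is counted `N` times and the box once, so the sums of squares total at most `3NB`;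
  -- times 4 this gives the 12.
  have : N ^ 2 * b q ^ 2 ≤ N ^ 2 * (12 / N * B + 4 * (N ^ 2 * η) ^ 2) := by
    have e : (N : ℝ) ^ 2 * (12 / N * B + 4 * (N ^ 2 * η) ^ 2)
        = 12 * (N * B) + 4 * (N ^ 2 * (N ^ 2 * η) ^ 2) := by
      field_simp
    rw [e]
    have t1 := mul_le_mul_of_nonneg_left s1 hN'.le
    have t2 := mul_le_mul_of_nonneg_left s2 hN'.le
    have t3 : B ≤ N * B := le_mul_of_one_le_left hB0 hN1
    linarith
  exact le_of_mul_le_mul_left this (by positivity)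

/-- Mixed differences of the sums of `a` over the translates of a rectangle. -/
theorem mixed_difference_sum_rectangle (a : ℤ × ℤ → ℝ) {M₁ M₂ N₁ N₂ : ℤ} (hM : M₁ ≤ M₂)
    (hN : N₁ ≤ N₂) {b : ℤ × ℤ → ℝ}
    (hb : ∀ q, b q = ∑ p ∈ Finset.Icc M₁ M₂ ×ˢ Finset.Icc N₁ N₂, a (p - q)) (r s : ℤ) :
    b (r + 1, s + 1) - b (r + 1, s) - (b (r, s + 1) - b (r, s))
      = a (M₁ - r - 1, N₁ - s - 1) - a (M₁ - r - 1, N₂ - s)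
        - (a (M₂ - r, N₁ - s - 1) - a (M₂ - r, N₂ - s)) := by
  -- Shifting an interval changes its sum by two boundary terms. Used once in each coordinate, this
  -- leaves four corner values, however large the rectangle.
  have tele : ∀ (g : ℤ → ℝ) (A C t : ℤ), A ≤ C →
      ∑ k ∈ Finset.Icc A C, g (k - (t + 1)) - ∑ k ∈ Finset.Icc A C, g (k - t)
        = g (A - t - 1) - g (C - t) := by
    intro g A C t hAC
    induction C, hAC using Int.leInduction with
    | base => simp [sub_sub]
    | succ n hn ih =>
      have e : Finset.Icc A (n + 1) = insert (n + 1) (Finset.Icc A n) := by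
        ext x
        simp only [Finset.mem_Icc, Finset.mem_insert]
        omega
      have hnm : n + 1 ∉ Finset.Icc A n := by simp
      rw [e, Finset.sum_insert hnm, Finset.sum_insert hnm]
      have : n + 1 - (t + 1) = n - t := by ring
      rw [this]
      linarith
  have hb' : ∀ r s, b (r, s)
      = ∑ j ∈ Finset.Icc M₁ M₂, ∑ k ∈ Finset.Icc N₁ N₂, a (j - r, k - s) := by
    intro r s
    rw [hb, Finset.sum_product]
    rfl
  have step : ∀ r, b (r, s + 1) - b (r, s)
      = ∑ j ∈ Finset.Icc M₁ M₂, (a (j - r, N₁ - s - 1) - a (j - r, N₂ - s)) := by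
    intro r
    rw [hb', hb', ← Finset.sum_sub_distrib]
    exact Finset.sum_congr rfl fun j _ => tele (fun y => a (j - r, y)) N₁ N₂ s hN
  rw [step, step]
  exact tele (fun x => a (x, N₁ - s - 1) - a (x, N₂ - s)) M₁ M₂ r hM

theorem abs_mixed_difference_sum_rectangle_le (a : lp (fun _ : ℤ × ℤ => ℝ) 2) {M₁ M₂ N₁ N₂ : ℤ}
    (hM : M₁ ≤ M₂) (hN : N₁ ≤ N₂) {b : ℤ × ℤ → ℝ}
    (hb : ∀ q, b q = ∑ p ∈ Finset.Icc M₁ M₂ ×ˢ Finset.Icc N₁ N₂, a (p - q)) (r s : ℤ) :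
    |b (r + 1, s + 1) - b (r + 1, s) - (b (r, s + 1) - b (r, s))| ≤ 4 * ‖a‖ := by
  rw [mixed_difference_sum_rectangle a hM hN hb]
  have h : ∀ p, |a p| ≤ ‖a‖ := fun p => lp.norm_apply_le_norm (by norm_num) a p
  refine (abs_sub _ _).trans ((add_le_add (abs_sub _ _) (abs_sub _ _)).trans ?_)
  linarith [h (M₁ - r - 1, N₁ - s - 1), h (M₁ - r - 1, N₂ - s), h (M₂ - r, N₁ - s - 1),
    h (M₂ - r, N₂ - s)]

/-! ### Characteristic functions under `L²` limits, and uniformity in families -/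

theorem norm_exp_I_sub_exp_I_le (x y : ℝ) :
    ‖Complex.exp (x * Complex.I) - Complex.exp (y * Complex.I)‖ ≤ |x - y| := by
  have e : Complex.exp (x * Complex.I) - Complex.exp (y * Complex.I)
      = Complex.exp (y * Complex.I) * (Complex.exp (Complex.I * (x - y : ℝ)) - 1) := by
    rw [mul_sub, ← Complex.exp_add, mul_one]
    push_cast
    ring_nf
  rw [e, norm_mul, Complex.norm_exp_ofReal_mul_I, one_mul]
  exact Real.norm_exp_I_mul_ofReal_sub_one_le

/-- The map `x ↦ exp (iux)` is `|u|`-Lipschitz, and the `L¹` norm is at most the `L²` norm under a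
probability measure. -/
theorem norm_charFun_map_sub_le {Ω : Type*} [MeasurableSpace Ω] {P : Measure Ω}
    [IsProbabilityMeasure P] (f g : Lp ℝ 2 P) (u : ℝ) :
    ‖charFun (P.map f) u - charFun (P.map g) u‖ ≤ |u| * ‖f - g‖ := by
  have hf : AEMeasurable f P := (Lp.aestronglyMeasurable f).aemeasurable
  have hg : AEMeasurable g P := (Lp.aestronglyMeasurable g).aemeasurable
  have int : ∀ f : Lp ℝ 2 P, Integrable (fun ω => Complex.exp (u * f ω * Complex.I)) P := by
    intro f
    have hf : AEMeasurable f P := (Lp.aestronglyMeasurable f).aemeasurable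
    refine (integrable_const (1 : ℝ)).mono' (by fun_prop) (ae_of_all _ fun ω => ?_)
    rw [← Complex.ofReal_mul, Complex.norm_exp_ofReal_mul_I]
  have idiff : Integrable (fun ω => |(f - g : Lp ℝ 2 P) ω|) P :=
    ((Lp.memLp (f - g)).integrable (by norm_num)).abs
  have hnorm : ∫ ω, |(f - g : Lp ℝ 2 P) ω| ∂P ≤ ‖f - g‖ := by
    rw [Lp.norm_def]
    simp_rw [← Real.norm_eq_abs]
    rw [integral_norm_eq_lintegral_enorm (Lp.aestronglyMeasurable _),
      ← eLpNorm_one_eq_lintegral_enorm]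
    exact ENNReal.toReal_mono (Lp.eLpNorm_ne_top _)
      (eLpNorm_le_eLpNorm_of_exponent_le (by norm_num) (Lp.aestronglyMeasurable _))
  rw [charFun_apply_real, charFun_apply_real, integral_map hf (by fun_prop),
    integral_map hg (by fun_prop), ← integral_sub (int f) (int g)]
  calc _ ≤ ∫ ω, |u| * |(f - g : Lp ℝ 2 P) ω| ∂P := by
        refine norm_integral_le_of_norm_le (idiff.const_mul _) ?_
        filter_upwards [Lp.coeFn_sub f g] with ω hω
        rw [hω, Pi.sub_apply, ← abs_mul, mul_sub]
        have := norm_exp_I_sub_exp_I_le (u * f ω) (u * g ω)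
        push_cast at this
        exact this
    _ = |u| * ∫ ω, |(f - g : Lp ℝ 2 P) ω| ∂P := integral_const_mul _ _
    _ ≤ _ := mul_le_mul_of_nonneg_left hnorm (abs_nonneg u)

theorem tendsto_charFun_map {Ω ι : Type*} [MeasurableSpace Ω] {P : Measure Ω}
    [IsProbabilityMeasure P] {l : Filter ι} {f : ι → Lp ℝ 2 P} {g : Lp ℝ 2 P}
    (h : Tendsto f l (nhds g)) (u : ℝ) :
    Tendsto (fun i => charFun (P.map (f i)) u) l (nhds (charFun (P.map g) u)) := by
  rw [tendsto_iff_norm_sub_tendsto_zero] at h ⊢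
  refine squeeze_zero (fun _ => norm_nonneg _) (fun i => norm_charFun_map_sub_le (f i) g u) ?_
  simpa using h.const_mul |u|

/-- Families of laws whose characteristic functions tend to the Gaussian one, pointwise but
uniformly in the family, have distribution functions tending to `Φ` uniformly. -/
theorem eventually_abs_cdf_sub_gaussian_le {L : ℝ → Set (ProbabilityMeasure ℝ)}
    (hL : ∀ t ε : ℝ, 0 < ε → ∀ᶠ κ in atTop, ∀ μ ∈ L κ,
      ‖charFun (μ : Measure ℝ) t - Real.exp (-(t ^ 2 / 2))‖ ≤ ε) {ε : ℝ} (hε : 0 < ε) :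
    ∀ᶠ κ in atTop, ∀ μ ∈ L κ, ∀ z,
      |cdf (μ : Measure ℝ) z - cdf (gaussianReal 0 1) z| ≤ ε := by
  -- A failure yields bad laws `μ n ∈ L (κ n)` with `κ n ≥ n`; they converge weakly to the Gaussian
  -- by Lévy, contradicting Pólya.
  by_contra hcon
  rw [eventually_atTop] at hcon
  push Not at hcon
  choose κ hκ μ hμ z hz using fun n : ℕ => hcon n
  have hκ' : Tendsto κ atTop atTop := tendsto_atTop_mono hκ tendsto_natCast_atTop_atTop
  let γ : ProbabilityMeasure ℝ := ⟨gaussianReal 0 1, inferInstance⟩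
  have : NullSingletonClass (γ : Measure ℝ) := nullSingletonClass_gaussianReal one_ne_zero
  have hlim : Tendsto μ atTop (nhds γ) := by
    refine ProbabilityMeasure.tendsto_of_tendsto_charFun fun t => ?_
    have e : charFun (γ : Measure ℝ) t = Real.exp (-(t ^ 2 / 2)) := by
      change charFun (gaussianReal 0 1) t = _
      rw [charFun_gaussianReal]
      simp
    rw [e, Metric.tendsto_nhds]
    intro δ hδ
    filter_upwards [hκ'.eventually (hL t (δ / 2) (half_pos hδ))] with n hn
    rw [dist_eq_norm]
    exact (hn _ (hμ n)).trans_lt (half_lt_self hδ)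
  obtain ⟨n, hn⟩ := (eventually_forall_abs_cdf_sub_le hlim hε).exists
  exact absurd (hn (z n)) (not_le.2 (hz n))

/-! ### Lindeberg's argument and the uniform limit -/

namespace LinearField

variable {Ω : Type*} [MeasurableSpace Ω] {P : Measure Ω} {F : ProbabilityMeasure ℝ}
  {ξ : ℤ × ℤ → Ω → ℝ}

theorem IsInnovations.charFun_map_sum (h : IsInnovations P F ξ) (w : ℤ × ℤ → ℝ)
    (s : Finset (ℤ × ℤ)) (u : ℝ) :
    charFun (P.map (∑ q ∈ s, w q • (h.memLp q).toLp (ξ q) : Lp ℝ 2 P)) u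
      = ∏ q ∈ s, charFun (F : Measure ℝ) (w q * u) := by
  have hae : (∑ q ∈ s, w q • (h.memLp q).toLp (ξ q) : Lp ℝ 2 P)
      =ᵐ[P] fun ω => ∑ q ∈ s, w q * ξ q ω := by
    have h1 : ∀ᵐ ω ∂P, ∀ q ∈ s, (w q • (h.memLp q).toLp (ξ q) : Lp ℝ 2 P) ω = w q * ξ q ω := by
      rw [eventually_all_finset]
      intro q _
      filter_upwards [Lp.coeFn_smul (w q) ((h.memLp q).toLp (ξ q)), (h.memLp q).coeFn_toLp]
        with ω h1 h2
      rw [h1, Pi.smul_apply, h2, smul_eq_mul]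
    filter_upwards [Lp.coeFn_finsetSum s fun q => w q • (h.memLp q).toLp (ξ q), h1] with ω h2 h3
    rw [h2, Finset.sum_apply]
    exact Finset.sum_congr rfl h3
  have hind : iIndepFun (fun q ω => w q * ξ q ω) P :=
    h.indep.comp (fun q x => w q * x) fun q => by fun_prop
  have hm : ∀ q, AEMeasurable (ξ q) P := fun q => (h.law q).aemeasurable
  rw [Measure.map_congr hae, iIndepFun.charFun_map_fun_finsetSum_eq_prod
    (fun q _ => (hm q).const_mul (w q)) (hind.restrict _), Finset.prod_apply]
  refine Finset.prod_congr rfl fun q _ => ?_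
  rw [charFun_map_mul_comp (hm q), (h.law q).map_eq]

/-- Lindeberg's estimate for an infinite weighted sum of innovations. -/
theorem IsInnovations.norm_charFun_map_sub_le [IsProbabilityMeasure P] (h : IsInnovations P F ξ)
    {w : ℤ × ℤ → ℝ} {T : Lp ℝ 2 P} {B : ℝ}
    (hT : HasSum (fun q => w q • (h.memLp q).toLp (ξ q)) T) (hB : HasSum (fun q => w q ^ 2) B)
    {c τ δ u : ℝ} (hc : 0 ≤ c) (hτ : ∫ x in {x : ℝ | c < |x|}, x ^ 2 ∂(F : Measure ℝ) ≤ τ)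
    (hδ : ∀ q, |w q * u| ≤ δ) :
    ‖charFun (P.map T) u - Real.exp (-(u ^ 2 * B / 2))‖
      ≤ u ^ 2 * B * (4 * (δ * c + τ) + δ ^ 2) := by
  have lim1 := tendsto_charFun_map hT u
  have lim2 : Tendsto (fun s : Finset (ℤ × ℤ) => (Real.exp (-(u ^ 2 * (∑ q ∈ s, w q ^ 2) / 2)) : ℂ))
      (SummationFilter.unconditional (ℤ × ℤ)).filter
      (nhds (Real.exp (-(u ^ 2 * B / 2)) : ℂ)) := by
    have : Continuous fun x : ℝ => (Real.exp (-(u ^ 2 * x / 2)) : ℂ) := by fun_prop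
    exact (this.tendsto B).comp hB
  -- It suffices to bound the finite partial sums, each compared with the Gaussian of its own
  -- variance.
  refine le_of_tendsto (lim1.sub lim2).norm (Eventually.of_forall fun s => ?_)
  have hδ0 : 0 ≤ δ := (abs_nonneg _).trans (hδ 0)
  have hτ0 : 0 ≤ τ := (integral_nonneg fun x => sq_nonneg x).trans hτ
  have e : (Real.exp (-(u ^ 2 * (∑ q ∈ s, w q ^ 2) / 2)) : ℂ)
      = ∏ q ∈ s, (Real.exp (-((w q * u) ^ 2 / 2)) : ℂ) := by
    rw [← Complex.ofReal_prod, ← Real.exp_sum, Finset.sum_neg_distrib, ← Finset.sum_div,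
      Finset.mul_sum]
    simp_rw [mul_pow, mul_comm]
  rw [h.charFun_map_sum, e]
  calc _ ≤ ∑ q ∈ s, ‖charFun (F : Measure ℝ) (w q * u) - (Real.exp (-((w q * u) ^ 2 / 2)) : ℂ)‖ := by
        refine norm_prod_sub_prod_le_sum _ _ _ (fun q _ => norm_charFun_le_one _) fun q _ => ?_
        rw [Complex.norm_real, Real.norm_eq_abs, Real.abs_exp, Real.exp_le_one_iff]
        have := sq_nonneg (w q * u)
        linarith
    _ ≤ ∑ q ∈ s, (w q * u) ^ 2 * (4 * (δ * c + τ) + δ ^ 2) := by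
        refine Finset.sum_le_sum fun q _ =>
          (h.standardized.norm_charFun_sub_exp_le hc hτ (w q * u)).trans ?_
        have := hδ q
        rw [← sq_abs (w q * u)]
        gcongr
    _ = u ^ 2 * (∑ q ∈ s, w q ^ 2) * (4 * (δ * c + τ) + δ ^ 2) := by
        rw [← Finset.sum_mul, Finset.mul_sum]
        simp_rw [mul_pow, mul_comm]
    _ ≤ _ := by
        have := sum_le_hasSum s (fun q _ => sq_nonneg (w q)) hB
        gcongr

/-- For `(a, Γ)` in `𝓡_κ` no weight contributes much to `σ`. -/
theorem weight_sq_le (h : IsInnovations P F ξ) {κ : ℝ} (hκ : 0 < κ)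
    {a : lp (fun _ : ℤ × ℤ => ℝ) 2} {Γ : Finset (ℤ × ℤ)} (hR : (a, Γ) ∈ R h κ) (q : ℤ × ℤ)
    {N : ℕ} (hN : 0 < N) :
    weight a Γ q ^ 2 ≤ (12 / N + 64 * N ^ 4 / κ ^ 2) * σ h a Γ ^ 2 := by
  obtain ⟨_, ⟨M₁, M₂, N₁, N₂, hM, hN', hΓ⟩, hσ⟩ := hR
  simp only at hΓ hσ
  have hs := hasSum_weight_sq h a Γ
  have h1 := sq_le_of_mixed_difference_le (b := weight a Γ)
    (fun s => sum_le_hasSum s (fun q _ => sq_nonneg _) hs)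
    (abs_mixed_difference_sum_rectangle_le a hM hN' (fun q => by rw [weight, hΓ])) q hN
  have h2 : ‖a‖ ^ 2 ≤ σ h a Γ ^ 2 / κ ^ 2 := by
    rw [le_div_iff₀ (by positivity), ← mul_pow]
    have := norm_nonneg a
    rw [mul_comm]
    gcongr
  calc _ ≤ _ := h1
    _ = 12 / N * σ h a Γ ^ 2 + 64 * N ^ 4 * ‖a‖ ^ 2 := by ring
    _ ≤ 12 / N * σ h a Γ ^ 2 + 64 * N ^ 4 * (σ h a Γ ^ 2 / κ ^ 2) := by gcongr
    _ = _ := by ring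

/-- The threshold for `κ` depends on `δ` alone: `N` is fixed first to make `12 / N` at most `δ ^ 2 /
2`, then `κ` absorbs `N ^ 4`. -/
theorem eventually_abs_weight_le {δ : ℝ} (hδ : 0 < δ) :
    ∀ᶠ κ : ℝ in atTop, 0 < κ ∧ ∀ (Ω : Type*) (_ : MeasurableSpace Ω) (P : Measure Ω)
      (F : ProbabilityMeasure ℝ) (ξ : ℤ × ℤ → Ω → ℝ) (h : IsInnovations P F ξ)
      (a : lp (fun _ : ℤ × ℤ => ℝ) 2) (Γ : Finset (ℤ × ℤ)), (a, Γ) ∈ R h κ →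
      ∀ q, |weight a Γ q| ≤ δ * σ h a Γ := by
  obtain ⟨N, hN⟩ := exists_nat_gt (24 / δ ^ 2)
  have hN0 : (0 : ℝ) < N := lt_trans (by positivity) hN
  have h1 : 12 / (N : ℝ) ≤ δ ^ 2 / 2 := by
    rw [div_lt_iff₀ (by positivity)] at hN
    rw [div_le_iff₀ hN0]
    linarith
  have h2 : Tendsto (fun κ : ℝ => 64 * (N : ℝ) ^ 4 / κ ^ 2) atTop (nhds 0) :=
    tendsto_const_nhds.div_atTop (tendsto_pow_atTop two_ne_zero)
  filter_upwards [eventually_gt_atTop 0,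
    h2.eventually (gt_mem_nhds (show 0 < δ ^ 2 / 2 by positivity))] with κ hκ hκN
  refine ⟨hκ, fun Ω _ P F ξ h a Γ hR q => ?_⟩
  have hσ0 : 0 ≤ σ h a Γ := Real.sqrt_nonneg _
  refine abs_le_of_sq_le_sq ?_ (by positivity)
  refine (weight_sq_le h hκ hR q (by exact_mod_cast hN0)).trans ?_
  rw [mul_pow]
  gcongr
  linarith

theorem measurable_S_div (h : IsInnovations P F ξ) (a : lp (fun _ : ℤ × ℤ => ℝ) 2)
    (Γ : Finset (ℤ × ℤ)) : Measurable fun ω => S h a Γ ω / σ h a Γ :=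
  (Lp.stronglyMeasurable _).measurable.div_const _

/-- The laws of the normalised sums `S(a, Γ) / σ(a, Γ)` with `(a, Γ)` in `𝓡_κ` and innovation
distribution in `𝓗`. -/
def normalizedLaws.{u} (𝓗 : Set (ProbabilityMeasure ℝ)) (κ : ℝ) : Set (ProbabilityMeasure ℝ) :=
  {μ | ∃ (Ω : Type u) (_ : MeasurableSpace Ω) (P : Measure Ω) (_ : IsProbabilityMeasure P)
    (F : ProbabilityMeasure ℝ) (ξ : ℤ × ℤ → Ω → ℝ) (h : IsInnovations P F ξ)
    (a : lp (fun _ : ℤ × ℤ => ℝ) 2) (Γ : Finset (ℤ × ℤ)),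
    F ∈ 𝓗 ∧ (a, Γ) ∈ R h κ ∧ (μ : Measure ℝ) = P.map fun ω => S h a Γ ω / σ h a Γ}

theorem IsInnovationClass.eventually_norm_charFun_sub_le.{u} {𝓗 : Set (ProbabilityMeasure ℝ)}
    (h𝓗 : IsInnovationClass 𝓗) (t ε : ℝ) (hε : 0 < ε) :
    ∀ᶠ κ in atTop, ∀ μ ∈ normalizedLaws.{u} 𝓗 κ,
      ‖charFun (μ : Measure ℝ) t - Real.exp (-(t ^ 2 / 2))‖ ≤ ε := by
  -- With this `τ` the tail term `4 * t ^ 2 * τ` is below `ε / 2`. It fixes `c`, and only then is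
  -- `δ` chosen, small in terms of `c`.
  obtain ⟨c, hc, htail⟩ := h𝓗.exists_tail_le (show 0 < ε / (8 * (t ^ 2 + 1)) by positivity)
  set τ := ε / (8 * (t ^ 2 + 1)) with hτ
  have hsmall : ∀ᶠ δ in nhdsWithin (0 : ℝ) (Set.Ioi 0),
      t ^ 2 * (4 * (|t| * δ * c + τ) + (|t| * δ) ^ 2) < ε := by
    have hcont : Continuous fun δ : ℝ => t ^ 2 * (4 * (|t| * δ * c + τ) + (|t| * δ) ^ 2) := by
      fun_prop
    refine (hcont.tendsto 0).mono_left nhdsWithin_le_nhds |>.eventually (gt_mem_nhds ?_)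
    have : τ * (8 * (t ^ 2 + 1)) = ε := div_mul_cancel₀ _ (by positivity)
    have : 0 < τ := by positivity
    simp only [mul_zero, zero_mul, zero_add, ne_eq, OfNat.ofNat_ne_zero, not_false_eq_true,
      zero_pow, add_zero]
    nlinarith [sq_nonneg t]
  obtain ⟨δ, hδlt, hδ0⟩ := (hsmall.and self_mem_nhdsWithin).exists
  filter_upwards [eventually_abs_weight_le.{u} hδ0] with κ hκ μ hμ
  obtain ⟨hκ0, hw⟩ := hκ
  obtain ⟨Ω, _, P, _, F, ξ, h, a, Γ, hF, hR, hμ⟩ := hμ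
  have hσ : 0 < σ h a Γ := (mul_pos hκ0 hR.1).trans_le hR.2.2
  -- The normalisation moves into the argument, so the estimate applies to `S` itself.
  have e1 : charFun (μ : Measure ℝ) t = charFun (P.map (S h a Γ)) ((σ h a Γ)⁻¹ * t) := by
    rw [hμ, ← charFun_map_mul_comp (Lp.aestronglyMeasurable _).aemeasurable]
    simp_rw [div_eq_inv_mul]
  have e2 : ((σ h a Γ)⁻¹ * t) ^ 2 * σ h a Γ ^ 2 = t ^ 2 := by field_simp
  have key := h.norm_charFun_map_sub_le (hasSum_S h a Γ) (hasSum_weight_sq h a Γ)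
    (u := (σ h a Γ)⁻¹ * t) (δ := |t| * δ) hc (htail F hF) (fun q => by
      rw [abs_mul, abs_mul, abs_inv, abs_of_pos hσ]
      calc |weight a Γ q| * ((σ h a Γ)⁻¹ * |t|)
          ≤ δ * σ h a Γ * ((σ h a Γ)⁻¹ * |t|) := by gcongr; exact hw Ω _ P F ξ h a Γ hR q
        _ = |t| * δ := by field_simp)
  rw [e2, ← e1] at key
  exact key.trans hδlt.le

end LinearField

theorem corollary2 (𝓗 : Set (ProbabilityMeasure ℝ)) (h𝓗 : LinearField.IsInnovationClass 𝓗)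
    (ε : ℝ) (hε : 0 < ε) :
    ∀ᶠ κ : ℝ in atTop,
      ∀ (Ω : Type*) (_ : MeasurableSpace Ω) (P : Measure Ω) (_ : IsProbabilityMeasure P)
        (F : ProbabilityMeasure ℝ) (ξ : ℤ × ℤ → Ω → ℝ) (h : LinearField.IsInnovations P F ξ),
        F ∈ 𝓗 →
        ∀ (a : lp (fun _ : ℤ × ℤ => ℝ) 2) (Γ : Finset (ℤ × ℤ)),
          (a, Γ) ∈ LinearField.R h κ →
          ∀ z : ℝ, |LinearField.G h a Γ z - LinearField.Φ z| ≤ ε := by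
  filter_upwards [eventually_abs_cdf_sub_gaussian_le h𝓗.eventually_norm_charFun_sub_le hε]
    with κ hκ Ω _ P _ F ξ h hF a Γ hR z
  have hm := LinearField.measurable_S_div h a Γ
  have hp : IsProbabilityMeasure (P.map fun ω => LinearField.S h a Γ ω / LinearField.σ h a Γ) :=
    Measure.isProbabilityMeasure_map hm.aemeasurable
  have key := hκ ⟨_, hp⟩ ⟨Ω, _, P, inferInstance, F, ξ, h, a, Γ, hF, hR, rfl⟩ z
  rw [ProbabilityMeasure.coe_mk, cdf_eq_real, cdf_eq_real,
    map_measureReal_apply hm measurableSet_Iic] at key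
  exact key
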